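/- Let $N\in\mathbb{N}$ and $d\ge 2$. Let $\mathcal{Q}={}^N\mathbb{R}^d$ be the manifold of $N$-element subsets of $\mathbb{R}^d$, let $\widehat{\mathcal{Q}}\subset(\mathbb{R}^d)^N$ be the open set of $N$-tuples $(x_1,\dots,x_N)$ of pairwise distinct points, and let $\pi:\widehat{\mathcal{Q}}\to\mathcal{Q}$, $\pi(x_1,\dots,x_N)=\{x_1,\dots,x_N\}$; the smooth structure of $\mathcal{Q}$ is the one for which $\pi$ is a local diffeomorphism. A Hermitian bundle is a smooth complex vector bundle of finite rank over a manifold with a connection and a positive-definite Hermitian inner product on each fiber that is preserved by parallel transport. An isomorphism of Hermitian bundles $E,E'$ over the same base is a family of unitary isomorphisms $I_q:E_q\to E'_q$ such that parallel transport along any (piecewise smooth) curve from $q$ to $r$ carries $I_q$ to $I_r$. Let $F$ be the fermionic line bundle over $\mathcal{Q}$, i.e., a Hermitian bundle of rank 1 such that, for every piecewise smooth closed curve $\alpha$ in $\mathcal{Q}$ based at $q$, parallel transport along $\alpha$ is multiplication by $(-1)^{\sigma_\alpha}$ on $F_q$, where $(-1)^{\sigma_\alpha}$ is the sign of the permutation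 $\sigma_\alpha$ of the set $q$ that maps the starting point of each of the $N$ curves in $\mathbb{R}^d$ that make up $\alpha$ to its end point. Let $\widehat{F}$ be the pull-back of $F$ through $\pi$, a Hermitian bundle over $\widehat{\mathcal{Q}}$ with fibers $\widehat{F}_{\hat q}=F_{\pi(\hat q)}$. Then for every global trivialization $\hat I$ of $\widehat F$, i.e., every isomorphism of Hermitian bundles $\hat I:\widehat{F}\to\widehat{\mathcal{Q}}\times\mathbb{C}$ onto the trivial Hermitian line bundle (with the trivial connection), and for every cross-section $\psi$ of $F$ (not necessarily continuous), the function $U\psi:\widehat{\mathcal{Q}}\to\mathbb{C}$ defined by $$(U\psi)(x_1,\dots,x_N)=\frac{1}{\sqrt{N!}}\,\hat I_{(x_1,\dots,x_N)}\,\psi(\{x_1,\dots,x_N\})$$ is anti-symmetric: for every permutation $\sigma$ of $\{1,\dots,N\}$ and every $(x_1,\dots,x_N)\in\widehat{\mathcal{Q}}$, $$(U\psi)(x_{\sigma(1)},\dots,x_{\sigma(N)})=(-1)^\sigma\,(U\psi)(x_1,\dots,x_N).$$ -/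

import Mathlib

open Bundle Set Filter
open scoped Manifold ContDiff Topology
set_option linter.unusedSectionVars false

noncomputable section

/-- Physical space `ℝ^d`. -/
abbrev Space (d : ℕ) : Type := EuclideanSpace ℝ (Fin d)

/-- `N`-tuples of points of `ℝ^d`. -/
abbrev Tuples (N d : ℕ) : Type := Fin N → Space d

/-- Ordered collision-free configurations, an open subset of `(ℝ^d)^N`. -/
def OrdConf (N d : ℕ) : TopologicalSpace.Opens (Tuples N d) :=
  ⟨{x | Function.Injective x}, by
    have h : {x : Tuples N d | Function.Injective x} =
        ⋂ (i : Fin N), ⋂ (j : Fin N), {x | i ≠ j → x i ≠ x j} := by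
      ext x
      simp only [mem_ofPred_eq, mem_iInter, Function.Injective, ne_eq]
      exact ⟨fun h i j hij e => hij (h e), fun h i j e => by_contra fun hij => h i j hij e⟩
    rw [h]
    refine isOpen_iInter_of_finite fun i => isOpen_iInter_of_finite fun j => ?_
    by_cases hij : i = j
    · simp [hij]
    · simpa [hij] using isOpen_ne_fun (continuous_apply i) (continuous_apply j)⟩

/-- Unordered configurations: the `N`-element subsets of `ℝ^d`. -/
def UnordConf (N d : ℕ) : Type := {q : Finset (Space d) // q.card = N}

namespace UnordConf
variable {N d : ℕ}

/-- The projection `(x₁, …, x_N) ↦ {x₁, …, x_N}`. -/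
def proj (x : OrdConf N d) : UnordConf N d :=
  ⟨Finset.univ.map ⟨x.1, x.2⟩, by simp⟩

lemma coe_proj (x : OrdConf N d) : ((proj x).1 : Set (Space d)) = range x.1 := by
  simp only [proj, Finset.coe_map, Finset.coe_univ, image_univ]
  rfl

lemma proj_eq_iff {x y : OrdConf N d} :
    proj x = proj y ↔ ∃ σ : Equiv.Perm (Fin N), y.1 = x.1 ∘ σ := by
  constructor
  · intro h
    have h' : range y.1 = range x.1 := by rw [← coe_proj, ← coe_proj, h]
    let ex := Equiv.ofInjective x.1 x.2
    let ey := Equiv.ofInjective y.1 y.2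
    refine ⟨ey.trans ((Equiv.setCongr h').trans ex.symm), ?_⟩
    funext i
    have := Equiv.apply_ofInjective_symm x.2 (Equiv.setCongr h' (ey i))
    exact this.symm
  · rintro ⟨σ, h⟩
    apply Subtype.ext
    apply Finset.coe_injective
    rw [coe_proj, coe_proj, h, range_comp, σ.surjective.range_eq, image_univ]

lemma proj_surjective : Function.Surjective (proj (N := N) (d := d)) := by
  rintro ⟨q, hq⟩
  let e := (Finset.equivFinOfCardEq hq).symm
  refine ⟨⟨fun i => (e i : Space d), fun i j h => e.injective (Subtype.ext h)⟩, ?_⟩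
  apply Subtype.ext
  apply Finset.coe_injective
  rw [coe_proj]
  ext a
  simp only [mem_range, Finset.mem_coe]
  exact ⟨fun ⟨i, hi⟩ => hi ▸ (e i).2, fun ha => ⟨e.symm ⟨a, ha⟩, by simp⟩⟩

/-- The quotient topology with respect to the projection. -/
instance : TopologicalSpace (UnordConf N d) := TopologicalSpace.coinduced proj inferInstance

lemma continuous_proj : Continuous (proj (N := N) (d := d)) := continuous_coinduced_rng

lemma isOpenMap_proj : IsOpenMap (proj (N := N) (d := d)) := by
  intro A hA
  rw [isOpen_coinduced]
  have : proj ⁻¹' (proj '' A) = ⋃ σ : Equiv.Perm (Fin N),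
      (fun y : OrdConf N d => (⟨y.1 ∘ σ, y.2.comp σ.injective⟩ : OrdConf N d)) ⁻¹' A := by
    ext y
    simp only [mem_preimage, mem_image, mem_iUnion]
    constructor
    · rintro ⟨x, hx, h⟩
      obtain ⟨σ, hσ⟩ := proj_eq_iff.1 h.symm
      exact ⟨σ, by convert! hx; exact Subtype.ext hσ.symm⟩
    · rintro ⟨σ, h⟩
      exact ⟨_, h, (proj_eq_iff.2 ⟨σ, rfl⟩).symm⟩
  rw [this]
  refine isOpen_iUnion fun σ => hA.preimage ?_
  exact Continuous.subtype_mk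
    (continuous_pi fun i => (continuous_apply (A := fun _ => Space d) (σ i)).comp continuous_subtype_val) _

/-- Near a collision-free tuple, the points of a configuration can be told apart. -/
lemma exists_separation {x : Tuples N d} (hx : Function.Injective x) :
    ∃ V : Fin N → Set (Space d), (∀ i, V i ∈ 𝓝 (x i)) ∧
      ∀ i j a, a ∈ V i → a ∈ V j → i = j := by
  obtain ⟨U, hU, hd⟩ := (finite_range x).t2_separation
  refine ⟨fun i => U (x i), fun i => (hU (x i)).2.mem_nhds (hU (x i)).1, fun i j a hi hj => ?_⟩
  by_contra hij
  exact Set.disjoint_left.1 (hd (mem_range_self i) (mem_range_self j) (hx.ne hij)) hi hj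

lemma isLocalHomeomorph_proj : IsLocalHomeomorph (proj (N := N) (d := d)) := by
  rw [isLocalHomeomorph_iff_isOpenEmbedding_restrict]
  intro x
  obtain ⟨V, hV, hs⟩ := exists_separation x.2
  let U : Set (OrdConf N d) := ⋂ i, {y | y.1 i ∈ interior (V i)}
  have hUo : IsOpen U := isOpen_iInter_of_finite fun i =>
    isOpen_interior.preimage ((continuous_apply i).comp continuous_subtype_val)
  have hxU : x ∈ U := mem_iInter.2 fun i => mem_interior_iff_mem_nhds.2 (hV i)
  refine ⟨U, hUo.mem_nhds hxU, ?_⟩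
  refine Topology.IsOpenEmbedding.of_continuous_injective_isOpenMap
    (continuous_proj.comp continuous_subtype_val) ?_ (isOpenMap_proj.domRestrict hUo)
  intro y z h
  obtain ⟨σ, hσ⟩ := proj_eq_iff.1 h
  apply Subtype.ext
  apply Subtype.ext
  rw [hσ]
  funext i
  have h1 : z.1.1 i ∈ V i := interior_subset (mem_iInter.1 z.2 i)
  have h2 : y.1.1 (σ i) ∈ V (σ i) := interior_subset (mem_iInter.1 y.2 (σ i))
  have h3 : z.1.1 i = y.1.1 (σ i) := congrFun hσ i
  rw [h3] at h1
  rw [Function.comp_apply, hs _ _ _ h2 h1]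

/-- The charts are the local inverses of the projection. -/
instance : ChartedSpace (Tuples N d) (UnordConf N d) :=
  isLocalHomeomorph_proj.chartedSpace proj_surjective

/-- A continuous map that only reorders the entries of collision-free tuples is smooth. -/
lemma contDiffAt_of_reorder {f : Tuples N d → Tuples N d} {x : Tuples N d}
    (hx : Function.Injective x) (hf : ContinuousAt f x)
    (h : ∀ᶠ y in 𝓝 x, ∃ σ : Equiv.Perm (Fin N), f y = y ∘ σ) : ContDiffAt ℝ ∞ f x := by
  obtain ⟨τ, hτ⟩ := h.self_of_nhds
  obtain ⟨V, hV, hs⟩ := exists_separation hx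
  have h1 : ∀ᶠ y in 𝓝 x, ∀ i, y i ∈ V i :=
    eventually_all.2 fun i => (continuous_apply i).continuousAt.eventually_mem (hV i)
  have h2 : ∀ᶠ y in 𝓝 x, ∀ i, f y i ∈ V (τ i) := by
    refine eventually_all.2 fun i => ?_
    have : ContinuousAt (fun y => f y i) x := (continuous_apply i).continuousAt.comp hf
    refine this.eventually_mem ?_
    rw [hτ]
    exact hV (τ i)
  have h3 : f =ᶠ[𝓝 x] fun y => y ∘ τ := by
    filter_upwards [h, h1, h2] with y ⟨σ, hσ⟩ hy1 hy2
    rw [hσ]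
    funext i
    have h4 := hy2 i
    rw [hσ] at h4
    rw [Function.comp_apply, Function.comp_apply, hs _ _ _ (hy1 (σ i)) h4]
  refine ContDiffAt.congr_of_eventuallyEq ?_ h3
  exact (contDiff_pi.2 fun i => contDiff_apply ℝ (Space d) (τ i)).contDiffAt

/-- The inverse of a chart composed with a chart reorders the entries of a tuple. -/
lemma chart_proj (q : UnordConf N d) (x : OrdConf N d)
    (h : proj x ∈ (chartAt (Tuples N d) q).source) :
    ∃ σ : Equiv.Perm (Fin N), chartAt (Tuples N d) q (proj x) = x.1 ∘ σ := by
  let g := Function.surjInv (proj_surjective (N := N) (d := d))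
  have hc : ∃ z : OrdConf N d, chartAt (Tuples N d) q =
    (isLocalHomeomorph_proj.localInverseAt z).trans (chartAt (Tuples N d) z) := ⟨_, rfl⟩
  obtain ⟨z, hz⟩ := hc
  rw [hz] at h ⊢
  have h1 : proj (isLocalHomeomorph_proj.localInverseAt z (proj x)) = proj x :=
    isLocalHomeomorph_proj.apply_localInverseAt_of_mem h.1
  exact proj_eq_iff.1 h1.symm

/-- The projection is smooth. -/
lemma contMDiff_proj : ContMDiff 𝓘(ℝ, Tuples N d) 𝓘(ℝ, Tuples N d) ∞ (proj (N := N) (d := d)) := by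
  classical
  intro x
  rw [contMDiffAt_iff_target]
  refine ⟨continuous_proj.continuousAt, ?_⟩
  let F : Tuples N d → Tuples N d := fun v =>
    if h : v ∈ OrdConf N d then chartAt (Tuples N d) (proj x) (proj ⟨v, h⟩) else v
  have hF : (extChartAt 𝓘(ℝ, Tuples N d) (proj x) ∘ proj) = fun y : OrdConf N d => F y := by
    funext y
    have : (y : Tuples N d) ∈ OrdConf N d := y.2
    simp [F]
  have hs : ∀ᶠ y : OrdConf N d in 𝓝 x, proj y ∈ (chartAt (Tuples N d) (proj x)).source :=
    continuous_proj.continuousAt.eventually_mem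
      ((chartAt (Tuples N d) (proj x)).open_source.mem_nhds (mem_chart_source _ _))
  have he := (OrdConf N d).isOpen.isOpenEmbedding_subtypeVal
  rw [hF]
  refine contMDiffAt_subtype_iff.2 (ContDiffAt.contMDiffAt ?_)
  refine contDiffAt_of_reorder x.2 ?_ ?_
  · refine he.continuousAt_iff.1 ?_
    change ContinuousAt (fun y : OrdConf N d => F y) x
    rw [← hF]
    exact (continuousAt_extChartAt _).comp continuous_proj.continuousAt
  · rw [← he.map_nhds_eq x, eventually_map]
    filter_upwards [hs] with y hy
    obtain ⟨σ, hσ⟩ := chart_proj _ _ hy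
    exact ⟨σ, by rw [← hσ]; simp [F]⟩

/-- The inverse of a chart is the projection. -/
lemma chart_symm_eq (q : UnordConf N d) {v : Tuples N d}
    (hv : v ∈ (chartAt (Tuples N d) q).target) :
    ∃ x : OrdConf N d, x.1 = v ∧ (chartAt (Tuples N d) q).symm v = proj x := by
  have hc : ∃ z : OrdConf N d, chartAt (Tuples N d) q =
    (isLocalHomeomorph_proj.localInverseAt z).trans (chartAt (Tuples N d) z) := ⟨_, rfl⟩
  obtain ⟨z, hz⟩ := hc
  rw [hz] at hv ⊢
  refine ⟨(chartAt (Tuples N d) z).symm v, (chartAt (Tuples N d) z).right_inv hv.1, ?_⟩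
  change (isLocalHomeomorph_proj.localInverseAt z).symm ((chartAt (Tuples N d) z).symm v) = _
  rw [IsLocalHomeomorph.localInverseAt_symm]

/-- Unordered configurations form a smooth manifold. -/
instance : IsManifold 𝓘(ℝ, Tuples N d) ∞ (UnordConf N d) := by
  refine isManifold_of_contDiffOn _ _ _ fun e e' he he' => ?_
  obtain ⟨q, rfl⟩ : ∃ q, chartAt (Tuples N d) q = e := he
  obtain ⟨q', rfl⟩ : ∃ q, chartAt (Tuples N d) q = e' := he'
  set T := (chartAt (Tuples N d) q).symm ≫ₕ chartAt (Tuples N d) q' with hT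
  have key : ∀ v ∈ T.source, ContDiffAt ℝ ∞ T v := by
    intro v hv
    obtain ⟨x, rfl, -⟩ := chart_symm_eq q hv.1
    refine contDiffAt_of_reorder x.2 (T.continuousAt hv) ?_
    filter_upwards [T.open_source.mem_nhds hv] with w hw
    obtain ⟨y, rfl, hy⟩ := chart_symm_eq q hw.1
    have h2 : (chartAt (Tuples N d) q).symm y.1 ∈ (chartAt (Tuples N d) q').source := hw.2
    rw [hy] at h2
    obtain ⟨σ, hσ⟩ := chart_proj q' y h2
    refine ⟨σ, ?_⟩
    change chartAt (Tuples N d) q' ((chartAt (Tuples N d) q).symm y.1) = _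
    rw [hy, hσ]
  intro v hv
  exact (key v hv.1).contDiffWithinAt

end UnordConf

section
variable {M M' : Type*} {E : M → Type*} 

instance [∀ x, AddCommGroup (E x)] (f : M' → M) (x : M') : AddCommGroup ((f *ᵖ E) x) :=
  inferInstanceAs (AddCommGroup (E (f x)))

instance [∀ x, AddCommGroup (E x)] [∀ x, TopologicalSpace (E x)]
    [∀ x, IsTopologicalAddGroup (E x)] (f : M' → M) (x : M') :
    IsTopologicalAddGroup ((f *ᵖ E) x) :=
  inferInstanceAs (IsTopologicalAddGroup (E (f x)))

instance [∀ x, AddCommGroup (E x)] [∀ x, TopologicalSpace (E x)]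
    [∀ x, Module ℝ (E x)] [∀ x, ContinuousSMul ℝ (E x)] (f : M' → M) (x : M') :
    ContinuousSMul ℝ ((f *ᵖ E) x) :=
  inferInstanceAs (ContinuousSMul ℝ (E (f x)))
end

section
variable {EB : Type*} [NormedAddCommGroup EB] [NormedSpace ℝ EB] {HB : Type*} [TopologicalSpace HB]
  {I : ModelWithCorners ℝ EB HB} {M : Type*} [TopologicalSpace M] [ChartedSpace HB M]
  {EB' : Type*} [NormedAddCommGroup EB'] [NormedSpace ℝ EB'] {HB' : Type*} [TopologicalSpace HB']
  {I' : ModelWithCorners ℝ EB' HB'} {M' : Type*} [TopologicalSpace M'] [ChartedSpace HB' M']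
  {F : Type*} [NormedAddCommGroup F] [NormedSpace ℝ F]
  {E : M → Type*} [∀ x, AddCommGroup (E x)] [∀ x, Module ℝ (E x)]
  [∀ x, TopologicalSpace (E x)] [∀ x, IsTopologicalAddGroup (E x)] [∀ x, ContinuousSMul ℝ (E x)]
  [TopologicalSpace (TotalSpace F E)] [FiberBundle F E] [VectorBundle ℝ F E]

variable (F) in
/-- The section near `x` that is constant, equal to `c`, in the preferred trivialization at `x`
(and zero where that trivialization is not defined). -/
def localConst (x : M) (c : F) : ∀ b, E b := fun b => (trivializationAt F E x).symmL ℝ b c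

lemma mdifferentiableAt_localConst (x : M) (c : F) :
    MDifferentiableAt I (I.prod 𝓘(ℝ, F))
      (fun b => TotalSpace.mk' F b (localConst (E := E) F x c b)) x := by
  rw [mdifferentiableAt_section]
  refine (mdifferentiableAt_const (c := c)).congr_of_eventuallyEq ?_
  filter_upwards [(trivializationAt F E x).open_baseSet.mem_nhds
    (mem_baseSet_trivializationAt F E x)] with b hb
  simp [localConst, hb]

lemma localConst_self (x : M) (v : E x) :
    localConst F x ((trivializationAt F E x).continuousLinearMapAt ℝ x v) x = v :=
  (trivializationAt F E x).symmL_continuousLinearMapAt (mem_baseSet_trivializationAt F E x) v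

/-- The components of a section of `f *ᵖ E` in the preferred trivialization of `E` at `f x`. -/
def pullbackCoord (f : C^∞⟮I', M'; I, M⟯) (s : ∀ y, ((f : M' → M) *ᵖ E) y) (x y : M') : F :=
  (trivializationAt F E (f x)).continuousLinearMapAt ℝ (f y) (s y)

lemma mdifferentiableAt_pullbackCoord (f : C^∞⟮I', M'; I, M⟯)
    {s : ∀ y, ((f : M' → M) *ᵖ E) y} {x : M'}
    (hs : MDifferentiableAt I' (I'.prod 𝓘(ℝ, F)) (fun y => TotalSpace.mk' F y (s y)) x) :
    MDifferentiableAt I' 𝓘(ℝ, F) (pullbackCoord (F := F) f s x) x := by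
  rw [mdifferentiableAt_section] at hs
  refine hs.congr_of_eventuallyEq ?_
  filter_upwards [f.contMDiff.continuous.continuousAt.eventually_mem
    ((trivializationAt F E (f x)).open_baseSet.mem_nhds
    (mem_baseSet_trivializationAt F E (f x)))] with y hy
  rw [pullbackCoord, Trivialization.continuousLinearMapAt_apply,
    Trivialization.coe_linearMapAt_of_mem _ hy]
  rfl

/-- The pull-back of a connection through a smooth map `f`. In a trivialization of `E` in which the
connection is `d + A`, it is `d + f^*A`: the section of `f *ᵖ E` with components `c` has at `x` the
covariant derivative `dc(X) + A(df(X)) c(x)`, and `A(Y) c` is the covariant derivative of the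
section with constant components `c`. -/
def pullbackConnection (cov : CovariantDerivative I F E) (f : C^∞⟮I', M'; I, M⟯) :
    CovariantDerivative I' F ((f : M' → M) *ᵖ E) where
  toFun s x :=
    ((trivializationAt F E (f x)).symmL ℝ (f x)).comp (mvfderiv I' (pullbackCoord f s x) x) +
      (cov (localConst F (f x) (pullbackCoord f s x x)) (f x)).comp (mfderiv I' I f x)
  isCovariantDerivativeOnUniv := {
    add := by
      intro s s' x hs hs' _
      have h1 : pullbackCoord (F := F) f (s + s') x = pullbackCoord f s x + pullbackCoord f s' x := by
        funext y
        exact map_add _ _ _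
      have h2 (c c' : F) : localConst (E := E) F (f x) (c + c') =
          localConst F (f x) c + localConst F (f x) c' := by
        funext b
        exact map_add _ _ _
      rw [h1, mvfderiv_add (mdifferentiableAt_pullbackCoord f hs)
        (mdifferentiableAt_pullbackCoord f hs'), Pi.add_apply, h2,
        cov.isCovariantDerivativeOnUniv.add (mdifferentiableAt_localConst _ _)
          (mdifferentiableAt_localConst _ _)]
      ext X
      have h3 := map_add ((trivializationAt F E (f x)).symmL ℝ (f x))
        (mvfderiv I' (pullbackCoord f s x) x X) (mvfderiv I' (pullbackCoord f s' x) x X)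
      refine (congrArg₂ (· + ·) h3 rfl).trans ?_
      exact add_add_add_comm _ _ _ _
    leibniz := by
      intro s g x hs hg _
      have h1 : pullbackCoord (F := F) f (g • s) x = g • pullbackCoord f s x := by
        funext y
        exact map_smul _ _ _
      have h2 (a : ℝ) (c : F) : localConst (E := E) F (f x) (a • c) =
          a • localConst F (f x) c := by
        funext b
        exact map_smul _ _ _
      have h3 := localConst_self (F := F) (f x) (s x)
      rw [h1, mvfderiv_smul hg (mdifferentiableAt_pullbackCoord f hs), Pi.smul_apply', h2,
        cov.isCovariantDerivativeOnUniv.smul_const _ (mdifferentiableAt_localConst _ _)]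
      ext X
      have h4 := map_add ((trivializationAt F E (f x)).symmL ℝ (f x))
        (g x • mvfderiv I' (pullbackCoord f s x) x X)
        (mvfderiv I' g x X • pullbackCoord (F := F) f s x x)
      rw [map_smul, map_smul] at h4
      have h5 : (trivializationAt F E (f x)).symmL ℝ (f x) (pullbackCoord f s x x) = s x := h3
      rw [h5] at h4
      refine (congrArg₂ (· + ·) h4 rfl).trans ?_
      refine (add_right_comm _ _ _).trans ?_
      exact congrArg₂ (· + ·) (smul_add (g x) (_ : E (f x)) _).symm rfl }

/-- The trivial connection `d` of the trivial bundle `M × W`. -/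
def trivialConnection (I : ModelWithCorners ℝ EB HB) (M : Type*) [TopologicalSpace M]
    [ChartedSpace HB M] (W : Type*) [NormedAddCommGroup W] [NormedSpace ℝ W] :
    CovariantDerivative I W (Bundle.Trivial M W) where
  toFun s x := mvfderiv I s x
  isCovariantDerivativeOnUniv := {
    add := by
      intro s s' x hs hs' _
      rw [mdifferentiableAt_section] at hs hs'
      exact mvfderiv_add hs hs'
    leibniz := by
      intro s g x hs hg _
      rw [mdifferentiableAt_section] at hs
      exact mvfderiv_smul hg hs }

/-- `p 0 = 0 < p 1 < ⋯ < p n = 1`. -/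
def IsSubdivision (n : ℕ) (p : ℕ → ℝ) : Prop :=
  p 0 = 0 ∧ p n = 1 ∧ ∀ i < n, p i < p (i + 1)

variable (I) in
/-- The restriction of `γ` to `[0, 1]` is a (continuous) piecewise smooth curve. -/
def IsPiecewiseSmooth (γ : ℝ → M) : Prop :=
  ∃ n p, IsSubdivision n p ∧
    ∀ i < n, ContMDiffOn 𝓘(ℝ, ℝ) I ∞ γ (Icc (p i) (p (i + 1)))

/-- The curve `U` in the total space of `E` is parallel on the interval `S`: in the preferred
trivialization at `U t`, where the connection is `d + A`, its components `c` satisfy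
`c'(t) = - A(γ'(t)) c(t)`, where `γ` is the curve in the base below `U`. -/
def IsParallelOn (cov : CovariantDerivative I F E) (U : ℝ → TotalSpace F E) (S : Set ℝ) : Prop :=
  ∀ t ∈ S,
    let x := (U t).proj
    let e := trivializationAt F E x
    HasDerivWithinAt (fun τ => (e (U τ)).2)
      (-e.continuousLinearMapAt ℝ x (cov (localConst F x (e (U t)).2) x
        (mfderivWithin 𝓘(ℝ, ℝ) I (fun τ => (U τ).proj) S t (1 : ℝ)))) S t

/-- Parallel transport along the piecewise smooth curve `γ : [0, 1] → M` maps `v` to `w`: there is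
a curve from `v` to `w` in the total space that lies above `γ` and is parallel on the pieces
of `γ`. -/
def IsParallelTransport (cov : CovariantDerivative I F E) (γ : ℝ → M) (v w : TotalSpace F E) :
    Prop :=
  ∃ U : ℝ → TotalSpace F E, (∀ t ∈ Icc (0 : ℝ) 1, (U t).proj = γ t) ∧ U 0 = v ∧ U 1 = w ∧
    ∃ n p, IsSubdivision n p ∧ ∀ i < n,
      ContMDiffOn 𝓘(ℝ, ℝ) I ∞ γ (Icc (p i) (p (i + 1))) ∧
      IsParallelOn cov U (Icc (p i) (p (i + 1)))
end

section
variable {F : Type*} [NormedAddCommGroup F] [NormedSpace ℂ F] {B : Type*} [TopologicalSpace B]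
  {E : B → Type*} [∀ x, AddCommGroup (E x)] [∀ x, Module ℂ (E x)]
  [∀ x, TopologicalSpace (E x)]
  [TopologicalSpace (TotalSpace F E)] [FiberBundle F E]

lemma isLinear_real [VectorBundle ℂ F E] (e : Trivialization F (π F E)) [MemTrivializationAtlas e] :
    e.IsLinear ℝ := by
  have := trivialization_linear ℂ e
  refine ⟨fun b hb => ⟨(this.linear b hb).map_add, fun c v => ?_⟩⟩
  have := (this.linear b hb).map_smul (c : ℂ) v
  simpa using this

/-- A complex vector bundle is a real vector bundle. -/
instance VectorBundle.complexToReal [VectorBundle ℂ F E] : VectorBundle ℝ F E where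
  trivialization_linear' e he := by
    exact isLinear_real e
  continuousOn_coordChange' e e' he he' := by
    have := isLinear_real e
    have := isLinear_real e'
    have h := continuousOn_coordChange ℂ e e'
    refine ((ContinuousLinearMap.restrictScalarsL ℂ F F ℝ ℝ).continuous.comp_continuousOn h).congr ?_
    intro b hb
    ext v
    change e.coordChangeL ℝ e' b v = e.coordChangeL ℂ e' b v
    rw [e.coordChangeL_apply e' hb, e.coordChangeL_apply e' hb]
end

section
variable {EB : Type*} [NormedAddCommGroup EB] [NormedSpace ℝ EB] {HB : Type*} [TopologicalSpace HB]
  {I : ModelWithCorners ℝ EB HB} {M : Type*} [TopologicalSpace M] [ChartedSpace HB M]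
  {EB' : Type*} [NormedAddCommGroup EB'] [NormedSpace ℝ EB'] {HB' : Type*} [TopologicalSpace HB']
  {I' : ModelWithCorners ℝ EB' HB'} {M' : Type*} [TopologicalSpace M'] [ChartedSpace HB' M']

/-- An inner product on every fiber and a connection on a complex vector bundle `E` over the real
manifold `M`. -/
structure HermitianData (I : ModelWithCorners ℝ EB HB) (F : Type*) [NormedAddCommGroup F]
    [NormedSpace ℝ F] (E : M → Type*) [∀ x, AddCommGroup (E x)] [∀ x, Module ℂ (E x)]
    [∀ x, Module ℝ (E x)] [∀ x, TopologicalSpace (E x)] [∀ x, IsTopologicalAddGroup (E x)]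
    [∀ x, ContinuousSMul ℝ (E x)] [TopologicalSpace (TotalSpace F E)] [FiberBundle F E] where
  metric : ∀ x, InnerProductSpace.Core ℂ (E x)
  connection : CovariantDerivative I F E

namespace HermitianData

section
variable {F : Type*} [NormedAddCommGroup F] [NormedSpace ℝ F] {E : M → Type*}
  [∀ x, AddCommGroup (E x)] [∀ x, Module ℂ (E x)] [∀ x, Module ℝ (E x)]
  [∀ x, TopologicalSpace (E x)] [∀ x, IsTopologicalAddGroup (E x)] [∀ x, ContinuousSMul ℝ (E x)]
  [TopologicalSpace (TotalSpace F E)] [FiberBundle F E] [VectorBundle ℝ F E]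

/-- The laws of a Hermitian bundle: the connection is smooth and complex linear, and the inner
product is parallel. -/
structure IsHermitianBundle [IsManifold I 1 M] (A : HermitianData I F E) : Prop where
  smooth : A.connection.ContMDiffCovariantDerivative ∞
  complex_linear : ∀ (s : ∀ x, E x) (x : M) (X : TangentSpace I x),
    MDifferentiableAt I (I.prod 𝓘(ℝ, F)) (fun y => TotalSpace.mk' F y (s y)) x →
      A.connection (Complex.I • s) x X = Complex.I • A.connection s x X
  parallel : ∀ (γ : ℝ → M) (x y : M) (v w : E x) (v' w' : E y),
    IsParallelTransport A.connection γ ⟨x, v⟩ ⟨y, v'⟩ →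
    IsParallelTransport A.connection γ ⟨x, w⟩ ⟨y, w'⟩ →
      (A.metric y).inner v' w' = (A.metric x).inner v w

/-- The pull-back of a Hermitian bundle; its fiber at `x` is the fiber of `E` at `f x`. -/
def pullback (A : HermitianData I F E) (f : C^∞⟮I', M'; I, M⟯) :
    HermitianData I' F ((f : M' → M) *ᵖ E) where
  metric x := A.metric (f x)
  connection := pullbackConnection A.connection f

variable {F' : Type*} [NormedAddCommGroup F'] [NormedSpace ℝ F'] {E' : M → Type*}
  [∀ x, AddCommGroup (E' x)] [∀ x, Module ℂ (E' x)] [∀ x, Module ℝ (E' x)]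
  [∀ x, TopologicalSpace (E' x)] [∀ x, IsTopologicalAddGroup (E' x)]
  [∀ x, ContinuousSMul ℝ (E' x)]
  [TopologicalSpace (TotalSpace F' E')] [FiberBundle F' E'] [VectorBundle ℝ F' E']

/-- An isomorphism of Hermitian bundles: a family of unitary maps between the fibers such that
parallel transport along any curve from `x` to `y` carries the map at `x` to the map at `y`. -/
structure Iso (A : HermitianData I F E) (A' : HermitianData I F' E') where
  toEquiv : ∀ x, E x ≃ₗ[ℂ] E' x
  inner_map : ∀ (x : M) (v w : E x),
    (A'.metric x).inner (toEquiv x v) (toEquiv x w) = (A.metric x).inner v w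
  map_parallel : ∀ (γ : ℝ → M) (x y : M) (v : E x) (w : E y),
    IsParallelTransport A.connection γ ⟨x, v⟩ ⟨y, w⟩ →
      IsParallelTransport A'.connection γ ⟨x, toEquiv x v⟩ ⟨y, toEquiv y w⟩
end

/-- The trivial Hermitian line bundle `M × ℂ`. -/
def trivialLine (I : ModelWithCorners ℝ EB HB) (M : Type*) [TopologicalSpace M]
    [ChartedSpace HB M] : HermitianData I ℂ (Bundle.Trivial M ℂ) where
  metric _ := InnerProductSpace.toCore
  connection := trivialConnection I M ℂ

end HermitianData
end

section
variable {N d : ℕ}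

/-- `σ` is the permutation of the configuration `q` defined by the loop `α`: `α` consists of one
continuous curve in `ℝ^d` for each point `a` of `q`, starting at `a` and ending at `σ a`. -/
def IsLoopPermutation (α : ℝ → UnordConf N d) (q : UnordConf N d)
    (σ : Equiv.Perm {a // a ∈ q.1}) : Prop :=
  ∃ c : {a // a ∈ q.1} → ℝ → Space d,
    (∀ a, ContinuousOn (c a) (Icc 0 1) ∧ c a 0 = a ∧ c a 1 = σ a) ∧
      ∀ t ∈ Icc (0 : ℝ) 1, ((α t).1 : Set (Space d)) = range fun a => c a t

variable {F : UnordConf N d → Type*} [∀ q, AddCommGroup (F q)] [∀ q, Module ℂ (F q)]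
  [∀ q, TopologicalSpace (F q)] [∀ q, IsTopologicalAddGroup (F q)]
  [∀ q, ContinuousSMul ℝ (F q)] [TopologicalSpace (TotalSpace ℂ F)] [FiberBundle ℂ F]
  [VectorBundle ℂ ℂ F]

open Classical in
/-- The defining property of the fermionic line bundle: it is a Hermitian line bundle in which the
holonomy of every piecewise smooth loop is the sign of the permutation defined by the loop. -/
structure IsFermionicLineBundle (A : HermitianData 𝓘(ℝ, Tuples N d) ℂ F) : Prop where
  hermitian : A.IsHermitianBundle
  holonomy : ∀ (q : UnordConf N d) (α : ℝ → UnordConf N d), IsPiecewiseSmooth 𝓘(ℝ, Tuples N d) α →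
    α 0 = q → α 1 = q → ∀ σ : Equiv.Perm {a // a ∈ q.1}, IsLoopPermutation α q σ →
      ∀ v w : F q, IsParallelTransport A.connection α ⟨q, v⟩ ⟨q, w⟩ ↔
        w = ((Equiv.Perm.sign σ : ℤ) : ℂ) • v

/-- The projection from ordered to unordered configurations as a smooth map. -/
def projMap (N d : ℕ) :
    C^∞⟮𝓘(ℝ, Tuples N d), OrdConf N d; 𝓘(ℝ, Tuples N d), UnordConf N d⟯ :=
  ⟨UnordConf.proj, UnordConf.contMDiff_proj⟩

/-- `U ψ (x) = (N!)^{-1/2} Î_x (ψ (π x))` for a cross-section `ψ` and a trivialization `Î` of the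
lifted bundle. -/
def liftedFunction {A : HermitianData 𝓘(ℝ, Tuples N d) ℂ F}
    (Ihat : (A.pullback (projMap N d)).Iso
      (HermitianData.trivialLine 𝓘(ℝ, Tuples N d) (OrdConf N d)))
    (ψ : ∀ q, F q) (x : OrdConf N d) : ℂ :=
  (1 / Real.sqrt (N.factorial : ℝ) : ℝ) * Ihat.toEquiv x (ψ (projMap N d x))

/-- The configuration `(x_{σ(1)}, …, x_{σ(N)})`. -/
def permute (σ : Equiv.Perm (Fin N)) (x : OrdConf N d) : OrdConf N d :=
  ⟨fun i => x.1 (σ i), x.2.comp σ.injective⟩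

/-- `f (x_{σ(1)}, …, x_{σ(N)}) = (-1)^σ f (x₁, …, x_N)` for all permutations `σ`. -/
def IsAntisymmetric (f : OrdConf N d → ℂ) : Prop :=
  ∀ (σ : Equiv.Perm (Fin N)) (x : OrdConf N d),
    f (permute σ x) = ((Equiv.Perm.sign σ : ℤ) : ℂ) * f x
end

end

/-! ### Parallel transport in pulled-back and trivial bundles -/

section
variable {EB : Type*} [NormedAddCommGroup EB] [NormedSpace ℝ EB] {HB : Type*} [TopologicalSpace HB]
  {I : ModelWithCorners ℝ EB HB} {M : Type*} [TopologicalSpace M] [ChartedSpace HB M]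
  {EB' : Type*} [NormedAddCommGroup EB'] [NormedSpace ℝ EB'] {HB' : Type*} [TopologicalSpace HB']
  {I' : ModelWithCorners ℝ EB' HB'} {M' : Type*} [TopologicalSpace M'] [ChartedSpace HB' M']
  {F : Type*} [NormedAddCommGroup F] [NormedSpace ℝ F]
  {E : M → Type*} [∀ x, AddCommGroup (E x)] [∀ x, Module ℝ (E x)]
  [∀ x, TopologicalSpace (E x)] [∀ x, IsTopologicalAddGroup (E x)] [∀ x, ContinuousSMul ℝ (E x)]
  [TopologicalSpace (TotalSpace F E)] [FiberBundle F E] [VectorBundle ℝ F E]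

/-! The tuples `x` and `permute σ x` order the same configuration `q`, so the fibers of the
pulled-back bundle over them are both `F q` and contain the same vector `ψ q`. A smooth curve `γ` in
`OrdConf N d` from `x` to `permute σ x` projects to a loop at `q` in which the point `x i` moves to
`x (σ i)`. By the fermionic holonomy, transport along this loop sends `ψ q` to `(-1)^σ ψ q`.

The same transport, read over `γ`, is parallel transport in the pulled-back bundle
(`IsParallelTransport.lift`). The trivialization carries it to transport in the trivial bundle,
which is the identity (`IsParallelTransport.trivial`). Hence `Î_x (ψ q) = (-1)^σ Î_{σx} (ψ q)`, and
`(-1)^σ` is its own inverse.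

The curve `γ` exists because `d ≥ 2` (`OrdConf.exists_smooth_curve`): the particles move first
towards a generic tuple and then on to the target, along straight lines and without collisions. -/

lemma IsSubdivision.Icc_subset {n : ℕ} {p : ℕ → ℝ} (h : IsSubdivision n p) {i : ℕ} (hi : i < n) :
    Icc (p i) (p (i + 1)) ⊆ Icc 0 1 := by
  have hm : ∀ j k, j ≤ k → k ≤ n → p j ≤ p k := by
    intro j k hjk
    induction k, hjk using Nat.le_induction with
    | base => exact fun _ => le_rfl
    | succ k _ ih => exact fun hk => (ih (by omega)).trans (h.2.2 k (by omega)).le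
  refine Icc_subset_Icc ?_ ?_
  · rw [← h.1]
    exact hm 0 i (by omega) (by omega)
  · rw [← h.2.1]
    exact hm (i + 1) n (by omega) le_rfl

lemma IsParallelOn.congr {cov : CovariantDerivative I F E} {U U' : ℝ → TotalSpace F E} {S : Set ℝ}
    (h : IsParallelOn cov U S) (hU : EqOn U' U S) : IsParallelOn cov U' S := by
  intro t ht
  have h1 := h t ht
  have h2 : mfderivWithin 𝓘(ℝ, ℝ) I (fun τ => (U' τ).proj) S t =
      mfderivWithin 𝓘(ℝ, ℝ) I (fun τ => (U τ).proj) S t :=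
    mfderivWithin_congr (fun τ hτ => by rw [hU hτ]) (by rw [hU ht])
  -- The trivialization itself depends on the point of the curve at time `t`, so `U' t = U t` cannot
  -- simply be rewritten. The point is generalized, and the velocity is taken in the model space
  -- `EB`, whose type does not depend on the base point.
  have key : ∀ u u' : TotalSpace F E, u' = u → ∀ X : EB,
      HasDerivWithinAt (fun τ => (trivializationAt F E u.proj (U τ)).2)
        (-(trivializationAt F E u.proj).continuousLinearMapAt ℝ u.proj
          (cov (localConst F u.proj (trivializationAt F E u.proj u).2) u.proj X)) S t →
      HasDerivWithinAt (fun τ => (trivializationAt F E u'.proj (U' τ)).2)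
        (-(trivializationAt F E u'.proj).continuousLinearMapAt ℝ u'.proj
          (cov (localConst F u'.proj (trivializationAt F E u'.proj u').2) u'.proj X)) S t := by
    rintro u _ rfl X h
    exact h.congr (fun τ hτ => by rw [hU hτ]) (by rw [hU ht])
  dsimp only
  rw [h2]
  exact key _ _ (hU ht) _ h1

/-- The preferred trivialization of the pull-back at `x` is the pull-back of the one at `f x`. The
components are therefore constant near `x`, and of `dc(X) + A(df(X)) c` only the second term
survives. -/
lemma pullbackConnection_localConst (cov : CovariantDerivative I F E) (f : C^∞⟮I', M'; I, M⟯)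
    (x : M') (c : F) (X : TangentSpace I' x) :
    pullbackConnection cov f (localConst (E := (f : M' → M) *ᵖ E) F x c) x X =
      cov (localConst F (f x) c) (f x) (mfderiv I' I f x X) := by
  have h1 : pullbackCoord (F := F) f (localConst (E := (f : M' → M) *ᵖ E) F x c) x =ᶠ[𝓝 x] fun _ => c := by
    filter_upwards [f.contMDiff.continuous.continuousAt.eventually_mem
      ((trivializationAt F E (f x)).open_baseSet.mem_nhds
      (mem_baseSet_trivializationAt F E (f x)))] with y hy
    have hy' : y ∈ (trivializationAt F ((f : M' → M) *ᵖ E) x).baseSet := hy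
    have h := (trivializationAt F ((f : M' → M) *ᵖ E) x).continuousLinearMapAt_symmL (R := ℝ) hy' c
    rw [Trivialization.continuousLinearMapAt_apply,
      Trivialization.coe_linearMapAt_of_mem _ hy'] at h
    rw [pullbackCoord, Trivialization.continuousLinearMapAt_apply,
      Trivialization.coe_linearMapAt_of_mem _ hy]
    exact h
  have h2 : mvfderiv I' (pullbackCoord (F := F) f (localConst (E := (f : M' → M) *ᵖ E) F x c) x) x = 0 := by
    rw [mvfderiv, h1.mfderiv_eq, mfderiv_const]
    ext; rfl
  change ((trivializationAt F E (f x)).symmL ℝ (f x))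
      (mvfderiv I' (pullbackCoord f (localConst (E := (f : M' → M) *ᵖ E) F x c) x) x X) +
    cov (localConst F (f x) (pullbackCoord f (localConst (E := (f : M' → M) *ᵖ E) F x c) x x)) (f x)
      (mfderiv I' I f x X) = _
  rw [h2, h1.self_of_nhds]
  refine (congrArg₂ (· + ·) (map_zero ((trivializationAt F E (f x)).symmL ℝ (f x))) rfl).trans ?_
  exact zero_add _

/-- A curve in the pulled-back bundle is parallel if the corresponding curve in the original
bundle is. -/
lemma IsParallelOn.of_pullback_lift {cov : CovariantDerivative I F E} (f : C^∞⟮I', M'; I, M⟯)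
    {V : ℝ → TotalSpace F ((f : M' → M) *ᵖ E)} {S : Set ℝ} (hS : UniqueDiffOn ℝ S)
    (hV : MDifferentiableOn 𝓘(ℝ, ℝ) I' (fun τ => (V τ).proj) S)
    (h : IsParallelOn cov (fun t => Pullback.lift f (V t)) S) :
    IsParallelOn (pullbackConnection cov f) V S := by
  intro t ht
  -- In corresponding trivializations both curves have the same components; the right-hand sides of
  -- the two equations agree by the chain rule for `f` along the base curve.
  have h1 := h t ht
  dsimp only at h1 ⊢
  rw [pullbackConnection_localConst]
  have h2 : mfderivWithin 𝓘(ℝ, ℝ) I (fun τ => f (V τ).proj) S t =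
      (mfderiv I' I f (V t).proj).comp
        (mfderivWithin 𝓘(ℝ, ℝ) I' (fun τ => (V τ).proj) S t) :=
    mfderiv_comp_mfderivWithin t (f.contMDiff.mdifferentiable (by simp) _) (hV t ht)
      (hS t ht).uniqueMDiffWithinAt
  have h3 : mfderivWithin 𝓘(ℝ, ℝ) I (fun τ => (Pullback.lift f (V τ)).proj) S t =
      (mfderiv I' I f (V t).proj).comp
        (mfderivWithin 𝓘(ℝ, ℝ) I' (fun τ => (V τ).proj) S t) := h2
  rw [h3] at h1
  exact h1

/-- Parallel transport lifts to the pulled-back bundle. -/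
lemma IsParallelTransport.lift {cov : CovariantDerivative I F E} (f : C^∞⟮I', M'; I, M⟯)
    {γ : ℝ → M'} (hγ : ContMDiff 𝓘(ℝ, ℝ) I' ∞ γ) {v w : TotalSpace F ((f : M' → M) *ᵖ E)}
    (hv : v.proj = γ 0) (hw : w.proj = γ 1)
    (h : IsParallelTransport cov (fun t => f (γ t)) (Pullback.lift f v) (Pullback.lift f w)) :
    IsParallelTransport (pullbackConnection cov f) γ v w := by
  obtain ⟨U, hU, hU0, hU1, n, p, hp, hpU⟩ := h
  -- The vector `U t` over `f (γ t)` is placed over `γ t`, where the fiber is the same. Outside `[0,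
  -- 1]` the curve `U` need not lie above `f ∘ γ`, and the zero vector is an arbitrary choice.
  have hex : ∀ t, ∃ z : TotalSpace F ((f : M' → M) *ᵖ E),
      z.proj = γ t ∧ (t ∈ Icc (0 : ℝ) 1 → Pullback.lift f z = U t) := by
    intro t
    by_cases ht : t ∈ Icc (0 : ℝ) 1
    · have h1 := hU t ht
      rcases hz : U t with ⟨b, e⟩
      rw [hz] at h1
      change b = f (γ t) at h1
      subst h1
      exact ⟨⟨γ t, e⟩, rfl, fun _ => rfl⟩
    · exact ⟨⟨γ t, (0 : E (f (γ t)))⟩, rfl, fun h => absurd h ht⟩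
  choose V hVp hVl using hex
  have hinj : ∀ z z' : TotalSpace F ((f : M' → M) *ᵖ E), z.proj = z'.proj →
      Pullback.lift f z = Pullback.lift f z' → z = z' := by
    rintro ⟨b, e⟩ ⟨b', e'⟩ h1 h2
    change b = b' at h1
    subst h1
    have h3 := TotalSpace.mk_inj.1 h2
    exact congrArg _ h3
  have hVγ : (fun τ => (V τ).proj) = γ := funext hVp
  refine ⟨V, fun t _ => hVp t, hinj _ _ ((hVp 0).trans hv.symm) ?_,
    hinj _ _ ((hVp 1).trans hw.symm) ?_, n, p, hp, fun i hi => ⟨hγ.contMDiffOn, ?_⟩⟩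
  · rw [hVl 0 (by simp), hU0]
  · rw [hVl 1 (by simp), hU1]
  · refine IsParallelOn.of_pullback_lift f (uniqueDiffOn_Icc (hp.2.2 i hi)) ?_ ?_
    · rw [hVγ]
      exact (hγ.mdifferentiable (by simp)).mdifferentiableOn
    · exact (hpU i hi).2.congr fun t ht => hVl t (hp.Icc_subset hi ht)

/-- Parallel transport of the trivial connection is trivial. -/
lemma IsParallelTransport.trivial {γ : ℝ → M} {x y : M} {v w : F}
    (h : IsParallelTransport (trivialConnection I M F) γ ⟨x, v⟩ ⟨y, w⟩) : v = w := by
  obtain ⟨U, hU, hU0, hU1, n, p, hp, hpU⟩ := h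
  have hstep : ∀ i < n, (U (p (i + 1))).2 = (U (p i)).2 := by
    intro i hi
    have hd : ∀ t ∈ Icc (p i) (p (i + 1)),
        HasDerivWithinAt (fun τ => ((U τ).2 : F)) 0 (Icc (p i) (p (i + 1))) t := by
      intro t ht
      have h1 := (hpU i hi).2 t ht
      have h2 : ∀ X, trivialConnection I M F (localConst (E := Bundle.Trivial M F) F (U t).proj
          ((trivializationAt F (Bundle.Trivial M F) (U t).proj) (U t)).2) (U t).proj X =
          (0 : F) := by
        intro X
        have h3 : localConst (E := Bundle.Trivial M F) F (U t).proj
            ((trivializationAt F (Bundle.Trivial M F) (U t).proj) (U t)).2 =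
            fun _ => ((trivializationAt F (Bundle.Trivial M F) (U t).proj) (U t)).2 := by
          funext b
          simp [localConst]
        rw [h3]
        change mvfderiv I _ _ X = 0
        rw [mvfderiv, mfderiv_const]
        rfl
      dsimp only at h1
      erw [h2, map_zero, neg_zero] at h1
      exact h1
    have := constant_of_derivWithin_zero (f := fun τ => ((U τ).2 : F))
      (fun t ht => (hd t ht).differentiableWithinAt)
      (fun t ht => (hd t ⟨ht.1, ht.2.le⟩).derivWithin
        ((uniqueDiffOn_Icc (hp.2.2 i hi)) t ⟨ht.1, ht.2.le⟩)) (p (i + 1))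
      ⟨(hp.2.2 i hi).le, le_rfl⟩
    exact this
  have hall : ∀ i ≤ n, ((U (p i)).2 : F) = (U (p 0)).2 := by
    intro i
    induction i with
    | zero => exact fun _ => rfl
    | succ i ih => exact fun hi => (hstep i (by omega)).trans (ih (by omega))
  have h1 := hall n le_rfl
  rw [hp.1, hp.2.1, hU0, hU1] at h1
  exact h1.symm

end

/-! ### Collision-free curves and the permutations of their loops -/

section
variable {N d : ℕ}

/-- Some `z` has no two entries whose difference is a multiple of the difference of the
corresponding entries of `x` or `y`. -/
lemma exists_generic_tuple (hd : 2 ≤ d) (x y : Tuples N d) :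
    ∃ z : Tuples N d, ∀ i j, i ≠ j →
      z i - z j ∉ Submodule.span ℝ {x i - x j} ∧ z i - z j ∉ Submodule.span ℝ {y i - y j} := by
  let D (i j : Fin N) : Tuples N d →ₗ[ℝ] Space d :=
    (LinearMap.proj i : Tuples N d →ₗ[ℝ] Space d) - LinearMap.proj j
  have hne : ∀ (i j : Fin N), i ≠ j → ∀ a : Space d,
      (Submodule.span ℝ {a}).comap (D i j) ≠ ⊤ := by
    intro i j hij a h
    have h1 : (⊤ : Submodule ℝ (Space d)) ≤ Submodule.span ℝ {a} := by
      intro b _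
      -- The tuple with `b` in place `i` and zeros elsewhere has difference `b`, so `D i j` is onto.
      have h2 : Pi.single i b ∈ (Submodule.span ℝ {a}).comap (D i j) := h ▸ Submodule.mem_top
      simpa [D, hij.symm] using h2
    have h3 := Submodule.finrank_mono h1
    have h4 : Module.finrank ℝ (Submodule.span ℝ {a}) ≤ 1 := by
      simpa using finrank_span_le_card (R := ℝ) ({a} : Set (Space d))
    rw [finrank_top, finrank_euclideanSpace_fin] at h3
    omega
  let P : {ij : Fin N × Fin N // ij.1 ≠ ij.2} × Bool → Submodule ℝ (Tuples N d) := fun k =>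
    (Submodule.span ℝ {if k.2 then x k.1.1.1 - x k.1.1.2 else y k.1.1.1 - y k.1.1.2}).comap
      (D k.1.1.1 k.1.1.2)
  have h := Subspace.biUnion_ne_univ_of_top_notMem (k := ℝ) (s := Finset.univ.image P) (by
    simp only [Finset.mem_image, Finset.mem_univ, true_and, not_exists]
    exact fun k => hne _ _ k.1.2 _)
  obtain ⟨z, hz⟩ := (Set.ne_univ_iff_exists_notMem _).1 h
  simp only [Finset.mem_image, Finset.mem_univ, true_and, iUnion_exists, iUnion_iUnion_eq',
    mem_iUnion, not_exists] at hz
  exact ⟨z, fun i j hij => ⟨hz ⟨⟨(i, j), hij⟩, true⟩, hz ⟨⟨(i, j), hij⟩, false⟩⟩⟩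

lemma affine_ne_zero_of_notMem_span {V : Type*} [AddCommGroup V] [Module ℝ V] {a c : V} (ha : a ≠ 0)
    (hc : c ∉ Submodule.span ℝ {a}) (s : ℝ) : (1 - s) • a + s • c ≠ 0 := by
  intro h
  by_cases hs : s = 0
  · simp [hs, ha] at h
  · refine hc (Submodule.mem_span_singleton.2 ⟨-(s⁻¹ * (1 - s)), ?_⟩)
    have h1 := congrArg (s⁻¹ • ·) (eq_neg_of_add_eq_zero_right h)
    simp only [smul_smul, inv_mul_cancel₀ hs, one_smul, smul_neg] at h1
    rw [h1, neg_smul]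

/-- Any two ordered configurations are joined by a smooth curve. -/
lemma OrdConf.exists_smooth_curve (hd : 2 ≤ d) (x y : OrdConf N d) :
    ∃ γ : ℝ → OrdConf N d, ContMDiff 𝓘(ℝ, ℝ) 𝓘(ℝ, Tuples N d) ∞ γ ∧ γ 0 = x ∧ γ 1 = y := by
  obtain ⟨z, hz⟩ := exists_generic_tuple hd x.1 y.1
  let r := Real.smoothTransition
  -- The segment from `x` to `z` for `t ≤ 1/2`, then the one from `z` to `y`. All derivatives of the
  -- smooth transition vanish at its ends, so the corner at `z` is passed smoothly.
  let g : ℝ → Tuples N d := fun t => x.1 + r (2 * t) • (z - x.1) + r (2 * t - 1) • (y.1 - z)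
  have hg : ∀ t, g t ∈ OrdConf N d := by
    intro t i j h
    by_contra hij
    have hx : x.1 i - x.1 j ≠ 0 := sub_ne_zero.2 (x.2.ne hij)
    have hy : y.1 i - y.1 j ≠ 0 := sub_ne_zero.2 (y.2.ne hij)
    rcases le_total (2 * t) 1 with ht | ht
    · have h1 : r (2 * t - 1) = 0 := Real.smoothTransition.zero_of_nonpos (by linarith)
      refine affine_ne_zero_of_notMem_span hx (hz i j hij).1 (r (2 * t)) ?_
      rw [← sub_eq_zero] at h
      rw [← h]
      simp only [g, h1, Pi.add_apply, Pi.smul_apply, Pi.sub_apply]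
      module
    · have h1 : r (2 * t) = 1 := Real.smoothTransition.one_of_one_le ht
      -- The second segment is read backwards, from `y` to `z`, so that `y i - y j` plays the role
      -- of `a`.
      refine affine_ne_zero_of_notMem_span hy (hz i j hij).2 (1 - r (2 * t - 1)) ?_
      rw [← sub_eq_zero] at h
      rw [← h]
      simp only [g, h1, Pi.add_apply, Pi.smul_apply, Pi.sub_apply]
      module
  have hr : ContDiff ℝ ∞ r := Real.smoothTransition.contDiff
  refine ⟨fun t => ⟨g t, hg t⟩, ?_, Subtype.ext ?_, Subtype.ext ?_⟩
  · refine (ContMDiff.subtypeVal_comp_iff _ _).1 (ContDiff.contMDiff ?_)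
    change ContDiff ℝ ∞ g
    fun_prop
  · have h0 : r 0 = 0 := Real.smoothTransition.zero
    have h1 : r (-1) = 0 := Real.smoothTransition.zero_of_nonpos (by norm_num)
    simp [g, h0, h1]
  · have h1 : r 1 = 1 := Real.smoothTransition.one
    have h2 : r 2 = 1 := Real.smoothTransition.one_of_one_le (by norm_num)
    have h3 : (2 : ℝ) - 1 = 1 := by norm_num
    simp [g, h1, h2, h3]

/-- The enumeration of the points of a configuration by an ordering of it. -/
noncomputable def UnordConf.enum (x : OrdConf N d) : Fin N ≃ {a // a ∈ (proj x).1} :=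
  Equiv.ofBijective
    (fun i => ⟨x.1 i, by rw [← Finset.mem_coe, coe_proj]; exact mem_range_self i⟩)
    ⟨fun i j h => x.2 (congrArg Subtype.val h), by
      rintro ⟨a, ha⟩
      rw [← Finset.mem_coe, coe_proj] at ha
      obtain ⟨i, hi⟩ := ha
      exact ⟨i, Subtype.ext hi⟩⟩

lemma UnordConf.proj_permute (σ : Equiv.Perm (Fin N)) (x : OrdConf N d) :
    proj (permute σ x) = proj x :=
  (proj_eq_iff.2 ⟨σ, rfl⟩).symm

/-- The loop below a curve from `x` to `permute σ x` defines the permutation `σ` of the points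
of `x`. -/
lemma isLoopPermutation_proj {γ : ℝ → OrdConf N d} (hγ : Continuous γ) (σ : Equiv.Perm (Fin N))
    {x : OrdConf N d} (h0 : γ 0 = x) (h1 : γ 1 = permute σ x) :
    IsLoopPermutation (fun t => UnordConf.proj (γ t)) (UnordConf.proj x)
      ((UnordConf.enum x).permCongr σ) := by
  -- The point `a = x i` follows the `i`-th component of `γ`, which ends at `x (σ i)`.
  refine ⟨fun a t => (γ t).1 ((UnordConf.enum x).symm a), fun a => ⟨?_, ?_, ?_⟩, fun t _ => ?_⟩
  · exact ((continuous_apply _).comp (continuous_subtype_val.comp hγ)).continuousOn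
  · change (γ 0).1 _ = _
    rw [h0]
    exact congrArg Subtype.val ((UnordConf.enum x).apply_symm_apply a)
  · change (γ 1).1 _ = _
    rw [h1]
    rfl
  · rw [UnordConf.coe_proj]
    exact ((UnordConf.enum x).symm.surjective.range_comp _).symm

end

/-! ### Antisymmetry of the lifted function -/

theorem mainTheorem6 (N d : ℕ) (hd : 2 ≤ d)
    {F : UnordConf N d → Type*} [∀ q, AddCommGroup (F q)] [∀ q, Module ℂ (F q)]
    [∀ q, TopologicalSpace (F q)] [∀ q, IsTopologicalAddGroup (F q)]
    [∀ q, ContinuousSMul ℝ (F q)] [TopologicalSpace (TotalSpace ℂ F)] [FiberBundle ℂ F]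
    [VectorBundle ℂ ℂ F] [ContMDiffVectorBundle ∞ ℂ F 𝓘(ℝ, Tuples N d)]
    (A : HermitianData 𝓘(ℝ, Tuples N d) ℂ F) (hA : IsFermionicLineBundle A)
    (Ihat : (A.pullback (projMap N d)).Iso
      (HermitianData.trivialLine 𝓘(ℝ, Tuples N d) (OrdConf N d)))
    (ψ : ∀ q, F q) :
    IsAntisymmetric (liftedFunction Ihat ψ) := by
  classical
  intro σ x
  obtain ⟨γ, hγ, h0, h1⟩ := OrdConf.exists_smooth_curve hd x (permute σ x)
  have hα : IsPiecewiseSmooth 𝓘(ℝ, Tuples N d) (fun t => UnordConf.proj (γ t)) :=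
    ⟨1, fun i => i, ⟨by simp, by simp, fun i _ => by simp⟩,
      fun i _ => (UnordConf.contMDiff_proj.comp hγ).contMDiffOn⟩
  -- The holonomy refers to a permutation of the points of the configuration; relabeling the points
  -- by indices preserves its sign.
  have hsign : Equiv.Perm.sign ((UnordConf.enum x).permCongr σ) = Equiv.Perm.sign σ :=
    Equiv.Perm.sign_permCongr _ _
  set s : ℂ := ((Equiv.Perm.sign σ : ℤ) : ℂ) with hs
  have hT : IsParallelTransport A.connection (fun t => UnordConf.proj (γ t))
      ⟨UnordConf.proj x, ψ (UnordConf.proj x)⟩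
      ⟨UnordConf.proj x, s • ψ (UnordConf.proj x)⟩ := by
    refine (hA.holonomy (UnordConf.proj x) _ hα (by rw [h0])
      (by rw [h1, UnordConf.proj_permute]) _
      (isLoopPermutation_proj hγ.continuous σ h0 h1) _ _).2 ?_
    rw [hs, ← hsign]
  -- The end vector must be presented in the fiber over `proj (permute σ x)` to be the lift of a
  -- vector over `permute σ x`.
  have hend : (⟨UnordConf.proj x, s • ψ (UnordConf.proj x)⟩ : TotalSpace ℂ F) =
      ⟨UnordConf.proj (permute σ x), s • ψ (UnordConf.proj (permute σ x))⟩ := by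
    rw [UnordConf.proj_permute]
  rw [hend] at hT
  have hL := IsParallelTransport.lift (projMap N d) hγ
    (v := ⟨x, ψ (projMap N d x)⟩)
    (w := ⟨permute σ x, s • ψ (projMap N d (permute σ x))⟩) h0.symm h1.symm hT
  have hI : Ihat.toEquiv x (ψ (projMap N d x)) =
      Ihat.toEquiv (permute σ x) (s • ψ (projMap N d (permute σ x))) :=
    IsParallelTransport.trivial (Ihat.map_parallel γ x (permute σ x) _ _ hL)
  have hss : s * s = 1 := by
    rcases Int.units_eq_one_or (Equiv.Perm.sign σ) with h | h <;> simp [hs, h]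
  have hsm : Ihat.toEquiv (permute σ x) (s • ψ (projMap N d (permute σ x))) =
      s * Ihat.toEquiv (permute σ x) (ψ (projMap N d (permute σ x))) :=
    map_smul (Ihat.toEquiv (permute σ x)) s _
  rw [hsm] at hI
  simp only [liftedFunction]
  rw [hI]
  linear_combination (-((1 / Real.sqrt (N.factorial : ℝ) : ℝ) : ℂ) *
    (Ihat.toEquiv (permute σ x) (ψ (projMap N d (permute σ x))) : ℂ)) * hss
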